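/- Let $d\ge 2$ be an integer. For $c>0$ let $\mathbb{D}_c^d=\{x\in\mathbb{R}^d:\|x\|<1/\sqrt c\}$ be the Poincaré ball of curvature $-c$, with Möbius addition $$x\oplus_c y=\frac{(1+2c\langle x,y\rangle+c\|y\|^2)\,x+(1-c\|x\|^2)\,y}{1+2c\langle x,y\rangle+c^2\|x\|^2\|y\|^2}$$ and hyperbolic distance $d_{\mathbb{D}}(x,y)=\frac{2}{\sqrt c}\,\mathrm{artanh}\bigl(\sqrt c\,\|(-x)\oplus_c y\|\bigr)$. For $\delta>0$ and $r>0$ let $N(r)=N_{d,c,\delta}(r)$ be the maximum number of points of $\mathbb{D}_c^d$ that lie within hyperbolic distance $r$ of the origin (that is, $d_{\mathbb{D}}(0,x)\le r$) and have pairwise hyperbolic distances at least $\delta$. Then $$N(r)=\Theta\bigl(e^{(d-1)\sqrt c\,(r-\delta/2)}\bigr)\qquad\text{for } r\ge\delta,$$ in the following uniform sense: for every $d\ge 2$ and $s>0$ there are constants $a,b>0$, depending only on $d$ and $s$, such that for all $c>0$, all $\delta>0$ with $\sqrt c\,\delta\ge s$ and all $r\ge\delta$, the maximum $N(r)$ exists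 (it is finite and attained) and $$a\,e^{(d-1)\sqrt c\,(r-\delta/2)}\;\le\;N(r)\;\le\;b\,e^{(d-1)\sqrt c\,(r-\delta/2)}.$$ In particular, for fixed $d$, $c$ and $\delta$ this holds for all $r\ge\delta$ with constants independent of $r$. -/

import Mathlib

noncomputable section

namespace PoincareBall

/-- The Poincaré ball of curvature `-c` (for `c > 0`): the open Euclidean ball of radius `1/√c`
about the origin of `ℝ^d`. -/
def carrier (c : ℝ) (d : ℕ) : Set (EuclideanSpace ℝ (Fin d)) :=
  {x | ‖x‖ < 1 / √c}

/-- Möbius addition `x ⊕_c y`. -/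
def mobiusAdd {d : ℕ} (c : ℝ) (x y : EuclideanSpace ℝ (Fin d)) : EuclideanSpace ℝ (Fin d) :=
  (1 + 2 * c * inner ℝ x y + c ^ 2 * ‖x‖ ^ 2 * ‖y‖ ^ 2)⁻¹ •
    ((1 + 2 * c * inner ℝ x y + c * ‖y‖ ^ 2) • x + (1 - c * ‖x‖ ^ 2) • y)

/-- Hyperbolic distance of the Poincaré ball of curvature `-c`, for points of `carrier c d`. -/
def hdist {d : ℕ} (c : ℝ) (x y : EuclideanSpace ℝ (Fin d)) : ℝ :=
  2 / √c * Real.artanh (√c * ‖mobiusAdd c (-x) y‖)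

/-- `S` is a family of points of the Poincaré ball, all within hyperbolic distance `r` of the
origin, any two distinct ones of which are at hyperbolic distance at least `δ`. -/
def IsDistinguishable {d : ℕ} (c δ r : ℝ) (S : Finset (EuclideanSpace ℝ (Fin d))) : Prop :=
  (∀ x ∈ S, x ∈ carrier c d ∧ hdist c 0 x ≤ r) ∧
    ∀ x ∈ S, ∀ y ∈ S, x ≠ y → δ ≤ hdist c x y

/-- The possible numbers of points in such a family. -/
def distinguishableCounts (d : ℕ) (c δ r : ℝ) : Set ℕ :=
  {n | ∃ S : Finset (EuclideanSpace ℝ (Fin d)), IsDistinguishable c δ r S ∧ S.card = n}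

/-- The representational capacity `N(r)`: the maximum number of `δ`-separated points within
hyperbolic distance `r` of the origin (`0` by convention if there is no maximum). -/
def capacity (d : ℕ) (c δ r : ℝ) : ℕ :=
  sSup (distinguishableCounts d c δ r)

end PoincareBall

end

/-! Write R = √c r, D = √c δ, n = d - 1. In polar coordinates the law of cosines
`cosh_sqrt_mul_hdist_polar` turns hyperbolic separation into Euclidean separation of directions, so
everything rests on packing the unit n-sphere: an optimal η-separated set there has about η^(-n)
points. For the lower bound, all points go on the sphere of radius R, where separation D means a
chord of about exp (D/2 - R). For the upper bound, the ball is cut into shells of thickness s/2. In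
the shell at radius L directions are separated by a multiple of exp (D/2 - L), so it holds O(1 + exp
(n(L - D/2))) points. The exponentials sum geometrically, dominated by the outermost shell; the O(R)
bounded terms are absorbed because r ≥ δ gives R - D/2 ≥ R/2. -/

open MeasureTheory Measure Metric Module

/-! ### Packing bounds on the Euclidean unit sphere -/

section SpherePacking

variable {E : Type*} [NormedAddCommGroup E]

/-- A finite set of unit vectors with pairwise distances at least `η`. -/
def IsSphereSeparated (η : ℝ) (T : Finset E) : Prop :=
  (∀ u ∈ T, ‖u‖ = 1) ∧ ∀ u ∈ T, ∀ v ∈ T, u ≠ v → η ≤ ‖u - v‖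

lemma IsSphereSeparated.mono {η η' : ℝ} (h : η' ≤ η) {T : Finset E}
    (hT : IsSphereSeparated η T) : IsSphereSeparated η' T :=
  ⟨hT.1, fun u hu v hv huv => h.trans (hT.2 u hu v hv huv)⟩

variable [NormedSpace ℝ E] [FiniteDimensional ℝ E] [Nontrivial E]

/-- Volume comparison in an annulus: keeping the central ball in the count makes the available
volume O(η), which gives the exponent n rather than n + 1. -/
lemma IsSphereSeparated.card_mul_pow_le {η : ℝ} (h0 : 0 < η) (h1 : η ≤ 1) {T : Finset E}
    (hT : IsSphereSeparated η T) :
    (T.card : ℝ) * (η / 2) ^ finrank ℝ E + (1 - η / 2) ^ finrank ℝ E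
      ≤ (1 + η / 2) ^ finrank ℝ E := by
  borelize E
  let μ : Measure E := addHaar
  have hV : 0 < μ.real (ball (0 : E) 1) :=
    ENNReal.toReal_pos (measure_ball_pos μ _ one_pos).ne' measure_ball_lt_top.ne
  have hball : ∀ (x : E) (t : ℝ), 0 ≤ t →
      μ.real (ball x t) = t ^ finrank ℝ E * μ.real (ball (0 : E) 1) := by
    intro x t ht
    rw [← addHaar_real_closedBall_eq_addHaar_real_ball, addHaar_real_closedBall μ x ht]
  have hdisj : (T : Set E).PairwiseDisjoint fun u => ball u (η / 2) := by
    intro u hu v hv huv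
    apply ball_disjoint_ball
    rw [dist_eq_norm]
    linarith [hT.2 u hu v hv huv]
  have hdisj0 : Disjoint (⋃ u ∈ T, ball u (η / 2)) (ball (0 : E) (1 - η / 2)) := by
    simp only [Set.disjoint_iUnion_left]
    intro u hu
    apply ball_disjoint_ball
    rw [dist_zero_right, hT.1 u hu]
    linarith
  have hsub : (⋃ u ∈ T, ball u (η / 2)) ∪ ball (0 : E) (1 - η / 2) ⊆ ball 0 (1 + η / 2) := by
    apply Set.union_subset
    · simp only [Set.iUnion_subset_iff]
      intro u hu
      apply ball_subset_ball'
      rw [dist_zero_right, hT.1 u hu]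
      linarith
    · apply ball_subset_ball
      linarith
  have hfin : μ (⋃ u ∈ T, ball u (η / 2)) ≠ ⊤ :=
    ((measure_mono (Set.subset_union_left.trans hsub)).trans_lt measure_ball_lt_top).ne
  have key := measureReal_mono (μ := μ) hsub measure_ball_lt_top.ne
  rw [measureReal_union hdisj0 measurableSet_ball hfin measure_ball_lt_top.ne,
    measureReal_biUnion_finset hdisj (fun _ _ => measurableSet_ball)
      (fun _ _ => measure_ball_lt_top.ne),
    Finset.sum_congr rfl (fun u _ => hball u (η / 2) (by linarith)), Finset.sum_const,
    hball _ (1 - η / 2) (by linarith), hball _ (1 + η / 2) (by linarith), nsmul_eq_mul] at key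
  refine le_of_mul_le_mul_right ?_ hV
  linarith

lemma IsSphereSeparated.card_le {n : ℕ} (hn : finrank ℝ E = n + 1) {η : ℝ} (h0 : 0 < η)
    (h1 : η ≤ 1) {T : Finset E} (hT : IsSphereSeparated η T) :
    (T.card : ℝ) ≤ (n + 1) * 4 ^ (n + 1) * (η⁻¹) ^ n := by
  have key := hT.card_mul_pow_le h0 h1
  rw [hn] at key
  have h2 : (1 + η / 2) ^ (n + 1) - (1 - η / 2) ^ (n + 1) ≤ η * (n + 1) * 2 ^ n := by
    have := (le_abs_self _).trans (abs_pow_sub_pow_le (1 + η / 2) (1 - η / 2) (n + 1))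
    refine this.trans ?_
    have ha : |1 + η / 2 - (1 - η / 2)| = η := by
      rw [show 1 + η / 2 - (1 - η / 2) = η by ring, abs_of_pos h0]
    rw [ha, abs_of_nonneg (by linarith : 0 ≤ 1 + η / 2), abs_of_nonneg (by linarith : 0 ≤ 1 - η / 2),
      max_eq_left (by linarith), Nat.add_sub_cancel]
    push_cast
    gcongr
    linarith
  have h3 : (T.card : ℝ) * (η / 2) ^ (n + 1) ≤ η * (n + 1) * 2 ^ n := by linarith
  have h4 : (0 : ℝ) < (η / 2) ^ (n + 1) := by positivity
  refine le_of_mul_le_mul_right (h3.trans ?_) h4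
  rw [div_pow, inv_pow, show (4 : ℝ) = 2 * 2 by norm_num, mul_pow, pow_succ η, pow_succ (2 : ℝ) n]
  field_simp
  norm_num

lemma exists_isSphereSeparated_card_ge {n : ℕ} (hn : finrank ℝ E = n + 1) {η : ℝ} (h0 : 0 < η)
    (h1 : η ≤ 1) :
    ∃ T : Finset E, IsSphereSeparated η T ∧ (2 ^ (n + 1))⁻¹ * (η⁻¹) ^ n ≤ (T.card : ℝ) := by
  classical
  let A : Set ℕ := {m | ∃ T : Finset E, IsSphereSeparated η T ∧ T.card = m}
  have hA : A.Nonempty := ⟨0, ∅, by simp [IsSphereSeparated], rfl⟩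
  have hbdd : BddAbove A := by
    refine ⟨⌊(n + 1) * 4 ^ (n + 1) * (η⁻¹) ^ n⌋₊, ?_⟩
    rintro m ⟨T, hT, rfl⟩
    exact Nat.le_floor (hT.card_le hn h0 h1)
  obtain ⟨T, hT, hcard⟩ := Nat.sSup_mem hA hbdd
  -- A separated set of maximal cardinality is an η-net of the sphere.
  have hmax : ∀ p : E, ‖p‖ = 1 → ∃ u ∈ T, ‖p - u‖ ≤ η := by
    intro p hp
    by_contra! hcon
    have hpT : p ∉ T := fun hmem => by
      have := hcon p hmem
      rw [sub_self, norm_zero] at this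
      linarith
    have hmem : (insert p T).card ∈ A := by
      refine ⟨insert p T, ⟨?_, ?_⟩, rfl⟩
      · intro u hu
        rcases Finset.mem_insert.1 hu with rfl | hu
        exacts [hp, hT.1 u hu]
      · intro u hu v hv huv
        rcases Finset.mem_insert.1 hu with rfl | hu' <;>
          rcases Finset.mem_insert.1 hv with rfl | hv'
        · exact absurd rfl huv
        · exact (hcon v hv').le
        · rw [norm_sub_rev]
          exact (hcon u hu').le
        · exact hT.2 u hu' v hv' huv
    have := le_csSup hbdd hmem
    rw [Finset.card_insert_of_notMem hpT] at this
    omega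
  refine ⟨T, hT, ?_⟩
  borelize E
  let μ : Measure E := addHaar
  have hV : 0 < μ.real (ball (0 : E) 1) :=
    ENNReal.toReal_pos (measure_ball_pos μ _ one_pos).ne' measure_ball_lt_top.ne
  -- Radial projection moves a point of the outer annulus by less than η, and the net costs another
  -- η.
  have hsub : ball (0 : E) 1 ⊆ closedBall 0 (1 - η) ∪ ⋃ u ∈ T, closedBall u (2 * η) := by
    intro x hx
    rw [mem_ball_zero_iff] at hx
    by_cases hxη : ‖x‖ ≤ 1 - η
    · exact Or.inl (mem_closedBall_zero_iff.2 hxη)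
    · right
      have hx0 : 0 < ‖x‖ := by linarith
      obtain ⟨u, hu, hxu⟩ := hmax (‖x‖⁻¹ • x) (by
        rw [norm_smul, norm_inv, norm_norm, inv_mul_cancel₀ hx0.ne'])
      simp only [Set.mem_iUnion]
      refine ⟨u, hu, ?_⟩
      rw [mem_closedBall, dist_eq_norm]
      have h3 : ‖x - ‖x‖⁻¹ • x‖ = 1 - ‖x‖ := by
        have : x - ‖x‖⁻¹ • x = (1 - ‖x‖⁻¹) • x := by rw [sub_smul, one_smul]
        rw [this, norm_smul, Real.norm_eq_abs, abs_of_nonpos, neg_sub, sub_mul, one_mul,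
          inv_mul_cancel₀ hx0.ne']
        have := (one_le_inv₀ hx0).2 hx.le
        linarith
      have := norm_sub_le_norm_sub_add_norm_sub x (‖x‖⁻¹ • x) u
      linarith
  have hfin : μ (closedBall 0 (1 - η) ∪ ⋃ u ∈ T, closedBall u (2 * η)) ≠ ⊤ := by
    refine ((isCompact_closedBall _ _).union ?_).measure_lt_top.ne
    exact T.isCompact_biUnion fun _ _ => isCompact_closedBall _ _
  have key := (measureReal_mono (μ := μ) hsub hfin).trans ((measureReal_union_le _ _).trans
    (add_le_add_right (measureReal_biUnion_finset_le T _) _))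
  rw [Finset.sum_congr rfl (fun u _ => addHaar_real_closedBall μ u (by linarith : 0 ≤ 2 * η)),
    addHaar_real_closedBall μ _ (by linarith), Finset.sum_const, nsmul_eq_mul, hn] at key
  have key2 : 1 ≤ (1 - η) ^ (n + 1) + T.card * (2 * η) ^ (n + 1) := by
    refine le_of_mul_le_mul_right ?_ hV
    linarith
  have h5 : (1 - η) ^ (n + 1) ≤ 1 - η := pow_le_of_le_one (by linarith) (by linarith) (by simp)
  have h6 : η ≤ T.card * (2 * η) ^ (n + 1) := by linarith
  have h7 : (0 : ℝ) < (2 * η) ^ (n + 1) := by positivity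
  refine le_of_mul_le_mul_right (le_trans (le_of_eq ?_) h6) h7
  rw [mul_pow, inv_pow, pow_succ η]
  field_simp

end SpherePacking

/-! ### Hyperbolic trigonometry in the ball -/

namespace PoincareBall

open Real

variable {d : ℕ} {c : ℝ}

lemma mul_norm_sq_lt_one (hc : 0 < c) {x : EuclideanSpace ℝ (Fin d)} (hx : x ∈ carrier c d) :
    c * ‖x‖ ^ 2 < 1 := by
  have hx' : ‖x‖ < 1 / √c := hx
  rw [lt_div_iff₀ (sqrt_pos.2 hc)] at hx'
  have h2 : (‖x‖ * √c) ^ 2 < 1 := pow_lt_one₀ (by positivity) hx' two_ne_zero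
  rw [mul_pow, sq_sqrt hc.le] at h2
  linarith

lemma mobius_denominator_pos (hc : 0 < c) {x y : EuclideanSpace ℝ (Fin d)}
    (hx : x ∈ carrier c d) (hy : y ∈ carrier c d) :
    0 < 1 - 2 * c * inner ℝ x y + c ^ 2 * ‖x‖ ^ 2 * ‖y‖ ^ 2 := by
  have h1 := mul_norm_sq_lt_one hc hx
  have h2 := mul_norm_sq_lt_one hc hy
  have h3 := norm_sub_sq_real x y
  nlinarith [mul_nonneg hc.le (sq_nonneg ‖x - y‖), mul_pos (sub_pos.2 h1) (sub_pos.2 h2)]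

lemma mul_norm_mobiusAdd_neg_sq (hc : 0 < c) {x y : EuclideanSpace ℝ (Fin d)}
    (hx : x ∈ carrier c d) (hy : y ∈ carrier c d) :
    ‖mobiusAdd c (-x) y‖ ^ 2 =
      ‖x - y‖ ^ 2 / (1 - 2 * c * inner ℝ x y + c ^ 2 * ‖x‖ ^ 2 * ‖y‖ ^ 2) := by
  have hD := mobius_denominator_pos hc hx hy
  have h3 := norm_sub_sq_real x y
  rw [mobiusAdd, norm_smul, mul_pow, inner_neg_left, norm_neg, smul_neg, neg_add_eq_sub,
    norm_sub_sq_real, norm_smul, norm_smul, inner_smul_left, inner_smul_right, h3,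
    real_inner_comm x y]
  simp only [norm_inv, norm_eq_abs, mul_pow, inv_pow, sq_abs, conj_trivial]
  rw [show 1 + 2 * c * -inner ℝ x y + c ^ 2 * ‖x‖ ^ 2 * ‖y‖ ^ 2
    = 1 - 2 * c * inner ℝ x y + c ^ 2 * ‖x‖ ^ 2 * ‖y‖ ^ 2 by ring, eq_div_iff hD.ne']
  field_simp
  ring

lemma sqrt_mul_norm_mobiusAdd_mem (hc : 0 < c) {x y : EuclideanSpace ℝ (Fin d)}
    (hx : x ∈ carrier c d) (hy : y ∈ carrier c d) :
    √c * ‖mobiusAdd c (-x) y‖ ∈ Set.Ico (0 : ℝ) 1 := by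
  refine ⟨by positivity, ?_⟩
  have hD := mobius_denominator_pos hc hx hy
  have h1 := mul_norm_sq_lt_one hc hx
  have h2 := mul_norm_sq_lt_one hc hy
  have h3 := norm_sub_sq_real x y
  rw [← sq_lt_one_iff₀ (by positivity), mul_pow, sq_sqrt hc.le, mul_norm_mobiusAdd_neg_sq hc hx hy,
    mul_div_assoc', div_lt_one hD, h3]
  nlinarith [mul_pos (sub_pos.2 h1) (sub_pos.2 h2)]

lemma sqrt_mul_hdist (hc : 0 < c) (x y : EuclideanSpace ℝ (Fin d)) :
    √c * hdist c x y = 2 * artanh (√c * ‖mobiusAdd c (-x) y‖) := by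
  have := sqrt_pos.2 hc
  rw [hdist]
  field_simp

lemma sqrt_mul_hdist_nonneg (hc : 0 < c) (x y : EuclideanSpace ℝ (Fin d)) :
    0 ≤ √c * hdist c x y := by
  rw [sqrt_mul_hdist hc]
  have := artanh_nonneg (x := √c * ‖mobiusAdd c (-x) y‖) (by positivity)
  linarith

lemma cosh_sqrt_mul_hdist (hc : 0 < c) {x y : EuclideanSpace ℝ (Fin d)}
    (hx : x ∈ carrier c d) (hy : y ∈ carrier c d) :
    cosh (√c * hdist c x y) =
      1 + 2 * c * ‖x - y‖ ^ 2 / ((1 - c * ‖x‖ ^ 2) * (1 - c * ‖y‖ ^ 2)) := by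
  have hD := mobius_denominator_pos hc hx hy
  have h1 := sub_pos.2 (mul_norm_sq_lt_one hc hx)
  have h2 := sub_pos.2 (mul_norm_sq_lt_one hc hy)
  have h3 := norm_sub_sq_real x y
  obtain ⟨h4, h5⟩ := sqrt_mul_norm_mobiusAdd_mem hc hx hy
  have h6 : (√c * ‖mobiusAdd c (-x) y‖) ^ 2 < 1 := by
    rwa [sq_lt_one_iff₀ h4]
  have hN := mul_norm_mobiusAdd_neg_sq hc hx hy
  rw [sqrt_mul_hdist hc, cosh_two_mul, cosh_sq, sinh_artanh ⟨by linarith, h5⟩, div_pow,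
    sq_sqrt (by linarith), mul_pow, sq_sqrt hc.le, hN]
  -- With t the argument of `artanh`, cosh (2 artanh t) = (1 + t²)/(1 - t²); this factorization
  -- evaluates 1 - t².
  have h7 : 1 - 2 * c * inner ℝ x y + c ^ 2 * ‖x‖ ^ 2 * ‖y‖ ^ 2 - c * ‖x - y‖ ^ 2 =
      (1 - c * ‖x‖ ^ 2) * (1 - c * ‖y‖ ^ 2) := by
    rw [h3]
    ring
  generalize 1 - 2 * c * inner ℝ x y + c ^ 2 * ‖x‖ ^ 2 * ‖y‖ ^ 2 = D at hD h7 ⊢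
  have h8 : 1 - c * (‖x - y‖ ^ 2 / D) = (1 - c * ‖x‖ ^ 2) * (1 - c * ‖y‖ ^ 2) / D := by
    rw [eq_div_iff hD.ne', ← h7]
    field_simp
  rw [h8]
  field_simp
  ring

/-- The point of the Poincaré ball at hyperbolic distance `ρ / √c` from the origin in the direction
of the unit vector `u`. -/
noncomputable def polar {d : ℕ} (c ρ : ℝ) (u : EuclideanSpace ℝ (Fin d)) : EuclideanSpace ℝ (Fin d) :=
  (tanh (ρ / 2) / √c) • u

lemma tanh_nonneg_of_nonneg {x : ℝ} (hx : 0 ≤ x) : 0 ≤ tanh x := by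
  rw [tanh_eq_sinh_div_cosh]
  exact div_nonneg (sinh_nonneg_iff.2 hx) (cosh_pos x).le

lemma norm_polar (c : ℝ) {ρ : ℝ} (hρ : 0 ≤ ρ) {u : EuclideanSpace ℝ (Fin d)} (hu : ‖u‖ = 1) :
    ‖polar c ρ u‖ = tanh (ρ / 2) / √c := by
  have := tanh_nonneg_of_nonneg (by linarith : 0 ≤ ρ / 2)
  rw [polar, norm_smul, hu, mul_one, norm_eq_abs, abs_of_nonneg (by positivity)]

lemma polar_mem_carrier (hc : 0 < c) {ρ : ℝ} (hρ : 0 ≤ ρ) {u : EuclideanSpace ℝ (Fin d)}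
    (hu : ‖u‖ = 1) : polar c ρ u ∈ carrier c d := by
  change ‖polar c ρ u‖ < 1 / √c
  rw [norm_polar c hρ hu]
  have := sqrt_pos.2 hc
  gcongr
  exact tanh_lt_one _

lemma hdist_zero_left (x : EuclideanSpace ℝ (Fin d)) :
    hdist c 0 x = 2 / √c * artanh (√c * ‖x‖) := by
  simp [hdist, mobiusAdd]

lemma hdist_zero_polar (hc : 0 < c) {ρ : ℝ} (hρ : 0 ≤ ρ) {u : EuclideanSpace ℝ (Fin d)}
    (hu : ‖u‖ = 1) : √c * hdist c 0 (polar c ρ u) = ρ := by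
  have := sqrt_pos.2 hc
  rw [hdist_zero_left, norm_polar c hρ hu, mul_div_cancel₀ _ this.ne', artanh_tanh]
  field_simp

lemma exists_eq_polar (hd : 0 < d) (hc : 0 < c) {x : EuclideanSpace ℝ (Fin d)}
    (hx : x ∈ carrier c d) :
    ∃ u : EuclideanSpace ℝ (Fin d), ‖u‖ = 1 ∧ x = polar c (√c * hdist c 0 x) u := by
  have hsc := sqrt_pos.2 hc
  have hx' : ‖x‖ < 1 / √c := hx
  rw [lt_div_iff₀ hsc] at hx'
  have h1 : ∀ u : EuclideanSpace ℝ (Fin d), polar c (√c * hdist c 0 x) u = ‖x‖ • u := by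
    intro u
    have h0 : 0 ≤ √c * ‖x‖ := by positivity
    rw [polar, hdist_zero_left, show √c * (2 / √c * artanh (√c * ‖x‖)) / 2 = artanh (√c * ‖x‖) by
      field_simp, tanh_artanh ⟨by linarith, by linarith⟩, mul_div_cancel_left₀ _ hsc.ne']
  rcases eq_or_ne x 0 with rfl | hx0
  · refine ⟨EuclideanSpace.single ⟨0, hd⟩ 1, by simp, ?_⟩
    rw [h1, norm_zero, zero_smul]
  · refine ⟨‖x‖⁻¹ • x, by rw [norm_smul, norm_inv, norm_norm, inv_mul_cancel₀ (by simpa)], ?_⟩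
    rw [h1, smul_smul, mul_inv_cancel₀ (by simpa), one_smul]

/-- The hyperbolic law of cosines about the origin. -/
lemma cosh_sqrt_mul_hdist_polar (hc : 0 < c) {ρ₁ ρ₂ : ℝ} (h1 : 0 ≤ ρ₁) (h2 : 0 ≤ ρ₂)
    {u v : EuclideanSpace ℝ (Fin d)} (hu : ‖u‖ = 1) (hv : ‖v‖ = 1) :
    cosh (√c * hdist c (polar c ρ₁ u) (polar c ρ₂ v)) =
      cosh (ρ₁ - ρ₂) + sinh ρ₁ * sinh ρ₂ * ‖u - v‖ ^ 2 / 2 := by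
  rw [cosh_sqrt_mul_hdist hc (polar_mem_carrier hc h1 hu) (polar_mem_carrier hc h2 hv),
    norm_sub_sq_real, norm_sub_sq_real, norm_polar c h1 hu, norm_polar c h2 hv, hu, hv]
  have hsc := sqrt_pos.2 hc
  obtain ⟨a, rfl⟩ : ∃ a, ρ₁ = 2 * a := ⟨ρ₁ / 2, by ring⟩
  obtain ⟨b, rfl⟩ : ∃ b, ρ₂ = 2 * b := ⟨ρ₂ / 2, by ring⟩
  rw [polar, polar, inner_smul_left, inner_smul_right, conj_trivial,
    mul_div_cancel_left₀ _ (two_ne_zero : (2 : ℝ) ≠ 0),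
    mul_div_cancel_left₀ _ (two_ne_zero : (2 : ℝ) ≠ 0), ← mul_sub, cosh_two_mul, cosh_sub, sinh_sub,
    sinh_two_mul, sinh_two_mul, div_pow, div_pow, sq_sqrt hc.le, tanh_eq_sinh_div_cosh,
    tanh_eq_sinh_div_cosh, mul_div_cancel₀ _ hc.ne', mul_div_cancel₀ _ hc.ne']
  have ha := cosh_sq a
  have hb := cosh_sq b
  have hca := cosh_pos a
  have hcb := cosh_pos b
  have e1 : 1 - (sinh a / cosh a) ^ 2 = 1 / cosh a ^ 2 := by
    field_simp
    linarith
  have e2 : 1 - (sinh b / cosh b) ^ 2 = 1 / cosh b ^ 2 := by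
    field_simp
    linarith
  rw [e1, e2]
  set i := inner ℝ u v
  have e3 : sinh a / cosh a / √c * (sinh b / cosh b / √c * i) =
      sinh a * sinh b * i / (cosh a * cosh b * c) := by
    rw [div_div, div_div, ← mul_assoc]
    nth_rewrite 3 [← sq_sqrt hc.le]
    field_simp
  rw [e3]
  field_simp
  linear_combination -ha - (cosh a ^ 2 - sinh a ^ 2) * hb

end PoincareBall

/-! ### Exponential estimates -/

namespace PoincareBall

open Real

lemma exp_mul_le_sinh {s x : ℝ} (h : s ≤ x) : exp x * ((1 - exp (-2 * s)) / 2) ≤ sinh x := by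
  rw [sinh_eq]
  have h1 : exp (-x) = exp x * exp (-2 * x) := by rw [← exp_add]; ring_nf
  have h2 : exp (-2 * x) ≤ exp (-2 * s) := exp_le_exp.2 (by linarith)
  rw [h1]
  nlinarith [mul_le_mul_of_nonneg_left h2 (exp_pos x).le]

lemma two_mul_sinh_le_exp (x : ℝ) : 2 * sinh x ≤ exp x := by
  rw [sinh_eq]
  linarith [exp_pos (-x)]

/-- Radii in one shell differ by at most s/2, so this gap is what the angular term of the law of
cosines must supply. -/
lemma exp_mul_le_cosh_sub_cosh {s D : ℝ} (hs : 0 < s) (h : s ≤ D) :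
    (1 - (cosh (s / 2))⁻¹) / 2 * exp D ≤ cosh D - cosh (s / 2) := by
  have h1 : cosh (s / 2) ≤ cosh (D / 2) := by
    rw [cosh_le_cosh, abs_of_pos (by linarith), abs_of_pos (by linarith)]
    linarith
  have h2 : cosh D = 2 * cosh (D / 2) ^ 2 - 1 := by
    have h := cosh_two_mul (D / 2)
    rw [sinh_sq, mul_div_cancel₀ _ (two_ne_zero : (2 : ℝ) ≠ 0)] at h
    linarith
  have h3 : exp (D / 2) ≤ 2 * cosh (D / 2) := by
    rw [cosh_eq]
    linarith [exp_pos (-(D / 2))]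
  have h4 : exp D ≤ 4 * cosh (D / 2) ^ 2 := by
    calc exp D = exp (D / 2) ^ 2 := by rw [← exp_nat_mul]; congr 1; push_cast; ring
      _ ≤ (2 * cosh (D / 2)) ^ 2 := by gcongr
      _ = _ := by ring
  have h5 : 1 ≤ cosh (s / 2) := one_le_cosh _
  set m := cosh (D / 2)
  set q := cosh (s / 2)
  have hq : 0 ≤ 1 - q⁻¹ := sub_nonneg.2 (inv_le_one_of_one_le₀ h5)
  have h6 : m * (1 - q⁻¹) ≤ m - 1 := by
    have : 1 ≤ m * q⁻¹ := by
      rw [← div_eq_mul_inv, one_le_div (by linarith)]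
      exact h1
    linarith
  have h7 : (1 - q⁻¹) / 2 * exp D ≤ 2 * m * (m * (1 - q⁻¹)) := by
    nlinarith [mul_le_mul_of_nonneg_left h4 hq]
  have h8 : 2 * m * (m * (1 - q⁻¹)) ≤ 2 * m * (m - 1) :=
    mul_le_mul_of_nonneg_left h6 (by linarith)
  nlinarith

variable {c : ℝ}

lemma le_hdist_iff (hc : 0 < c) {d : ℕ} {δ : ℝ} (hδ : 0 < δ) {x y : EuclideanSpace ℝ (Fin d)} :
    δ ≤ hdist c x y ↔ cosh (√c * δ) ≤ cosh (√c * hdist c x y) := by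
  have hsc := sqrt_pos.2 hc
  rw [cosh_le_cosh, abs_of_pos (by positivity), abs_of_nonneg (sqrt_mul_hdist_nonneg hc x y),
    mul_le_mul_iff_right₀ hsc]

/-! ### Lower bound: points on the outer sphere -/

lemma exists_isDistinguishable_card_ge (n : ℕ) {s : ℝ} (hs : 0 < s) (hc : 0 < c) {δ r : ℝ}
    (hδ : 0 < δ) (hsδ : s ≤ √c * δ) (hr : δ ≤ r) :
    ∃ S : Finset (EuclideanSpace ℝ (Fin (n + 1))), IsDistinguishable c δ r S ∧
      (2 ^ (n + 1))⁻¹ * ((1 - exp (-2 * s)) / 2) ^ n * exp (n * (√c * r - √c * δ / 2)) ≤ S.card := by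
  classical
  have hsc := sqrt_pos.2 hc
  set R := √c * r with hR
  set D := √c * δ with hD
  have hDR : D ≤ R := mul_le_mul_of_nonneg_left hr hsc.le
  have hD0 : 0 < D := by positivity
  have hR0 : 0 < R := hD0.trans_le hDR
  have hsD : 0 < sinh (D / 2) := sinh_pos_iff.2 (by linarith)
  have hsR : 0 < sinh R := sinh_pos_iff.2 hR0
  -- This is the exact chord between directions of two points at radius R and distance D.
  have hη0 : 0 < 2 * sinh (D / 2) / sinh R := by positivity
  have hη1 : 2 * sinh (D / 2) / sinh R ≤ 1 := by
    rw [div_le_one hsR]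
    refine le_trans ?_ (sinh_le_sinh.2 hDR)
    have h := sinh_two_mul (D / 2)
    rw [mul_div_cancel₀ _ (two_ne_zero : (2 : ℝ) ≠ 0)] at h
    rw [h]
    nlinarith [one_le_cosh (D / 2)]
  obtain ⟨T, hT, hcard⟩ := exists_isSphereSeparated_card_ge
    (E := EuclideanSpace ℝ (Fin (n + 1))) (n := n) (by simp) hη0 hη1
  have hdist_le : ∀ u ∈ T, ∀ v ∈ T, u ≠ v → δ ≤ hdist c (polar c R u) (polar c R v) := by
    intro u hu v hv huv
    rw [le_hdist_iff hc hδ, cosh_sqrt_mul_hdist_polar hc hR0.le hR0.le (hT.1 u hu) (hT.1 v hv),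
      sub_self, cosh_zero, ← hD]
    have h1 := hT.2 u hu v hv huv
    rw [div_le_iff₀ hsR] at h1
    have h2 : (2 * sinh (D / 2)) ^ 2 ≤ (‖u - v‖ * sinh R) ^ 2 := by gcongr
    have h3 : cosh D = 1 + 2 * sinh (D / 2) ^ 2 := by
      have h := cosh_two_mul (D / 2)
      rw [cosh_sq, mul_div_cancel₀ _ (two_ne_zero : (2 : ℝ) ≠ 0)] at h
      linarith
    rw [h3]
    nlinarith
  have hinj : Set.InjOn (polar c R) (T : Set (EuclideanSpace ℝ (Fin (n + 1)))) := by
    intro u _ v _ huv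
    refine smul_right_injective _ ?_ huv
    have : 0 < tanh (R / 2) := by
      rw [tanh_eq_sinh_div_cosh]
      exact div_pos (sinh_pos_iff.2 (by linarith)) (cosh_pos _)
    positivity
  refine ⟨T.image (polar c R), ⟨?_, ?_⟩, ?_⟩
  · intro x hx
    obtain ⟨u, hu, rfl⟩ := Finset.mem_image.1 hx
    refine ⟨polar_mem_carrier hc hR0.le (hT.1 u hu), le_of_eq ?_⟩
    exact mul_left_cancel₀ hsc.ne' (hdist_zero_polar hc hR0.le (hT.1 u hu))
  · intro x hx y hy hxy
    obtain ⟨u, hu, rfl⟩ := Finset.mem_image.1 hx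
    obtain ⟨v, hv, rfl⟩ := Finset.mem_image.1 hy
    exact hdist_le u hu v hv fun h => hxy (by rw [h])
  · rw [Finset.card_image_of_injOn hinj]
    refine le_trans ?_ hcard
    have hs1 : 0 < 1 - exp (-2 * s) := sub_pos.2 (exp_lt_one_iff.2 (by linarith))
    rw [mul_assoc, exp_nat_mul, ← mul_pow]
    gcongr
    rw [inv_div, le_div_iff₀ (by positivity)]
    calc (1 - exp (-2 * s)) / 2 * exp (R - D / 2) * (2 * sinh (D / 2))
        ≤ (1 - exp (-2 * s)) / 2 * exp (R - D / 2) * exp (D / 2) := by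
          gcongr
          exact two_mul_sinh_le_exp _
      _ = exp R * ((1 - exp (-2 * s)) / 2) := by
          rw [mul_assoc, ← exp_add, sub_add_cancel, mul_comm]
      _ ≤ sinh R := exp_mul_le_sinh (hsδ.trans hDR)

/-! ### Upper bound: thin shells -/

lemma IsDistinguishable.subset {d : ℕ} {δ r : ℝ} {S S' : Finset (EuclideanSpace ℝ (Fin d))}
    (h : IsDistinguishable c δ r S) (hS : S' ⊆ S) : IsDistinguishable c δ r S' :=
  ⟨fun x hx => h.1 x (hS hx), fun x hx y hy hxy => h.2 x (hS hx) y (hS hy) hxy⟩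

lemma IsDistinguishable.card_le_of_shell {n : ℕ} {s : ℝ} (hs : 0 < s) (hc : 0 < c) {δ r : ℝ}
    (hδ : 0 < δ) (hsδ : s ≤ √c * δ) {S : Finset (EuclideanSpace ℝ (Fin (n + 1)))}
    (hS : IsDistinguishable c δ r S) {L : ℝ}
    (hL : ∀ x ∈ S, L ≤ √c * hdist c 0 x ∧ √c * hdist c 0 x ≤ L + s / 2)
    {κ : ℝ} (hκ : 0 < κ) (hκ2 : κ ^ 2 = 4 * (1 - (cosh (s / 2))⁻¹) * exp (-s)) :
    (S.card : ℝ) ≤ (n + 1) * 4 ^ (n + 1) *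
      (1 + (κ⁻¹) ^ n * exp (n * (L - √c * δ / 2))) := by
  classical
  set D := √c * δ with hD
  choose! u hu using fun x (hx : x ∈ S) => exists_eq_polar n.succ_pos hc (hS.1 x hx).1
  have hsep : ∀ x ∈ S, ∀ y ∈ S, x ≠ y → κ * exp (D / 2 - L) ≤ ‖u x - u y‖ := by
    intro x hx y hy hxy
    have h1 := (le_hdist_iff hc hδ).1 (hS.2 x hx y hy hxy)
    have hx0 := sqrt_mul_hdist_nonneg hc 0 x
    have hy0 := sqrt_mul_hdist_nonneg hc 0 y
    obtain ⟨hLx, hLx'⟩ := hL x hx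
    obtain ⟨hLy, hLy'⟩ := hL y hy
    rw [(hu x hx).2, (hu y hy).2, cosh_sqrt_mul_hdist_polar hc hx0 hy0 (hu x hx).1 (hu y hy).1,
      ← hD] at h1
    set ρ₁ := √c * hdist c 0 x
    set ρ₂ := √c * hdist c 0 y
    have h2 : cosh (ρ₁ - ρ₂) ≤ cosh (s / 2) := by
      rw [cosh_le_cosh, abs_of_pos (by linarith : 0 < s / 2), abs_le]
      constructor <;> linarith
    have h3 : sinh ρ₁ * sinh ρ₂ ≤ exp (2 * L + s) / 4 := by
      have e1 : 2 * sinh ρ₁ ≤ exp (L + s / 2) :=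
        (two_mul_sinh_le_exp _).trans (exp_le_exp.2 hLx')
      have e2 : 2 * sinh ρ₂ ≤ exp (L + s / 2) :=
        (two_mul_sinh_le_exp _).trans (exp_le_exp.2 hLy')
      have e3 : exp (2 * L + s) = exp (L + s / 2) * exp (L + s / 2) := by
        rw [← exp_add]
        ring_nf
      have := mul_le_mul e1 e2 (mul_nonneg zero_le_two (sinh_nonneg_iff.2 hy0)) (exp_pos _).le
      rw [e3]
      linarith
    have h4 := exp_mul_le_cosh_sub_cosh hs hsδ
    have h5 : (1 - (cosh (s / 2))⁻¹) / 2 * exp D ≤ exp (2 * L + s) / 8 * ‖u x - u y‖ ^ 2 := by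
      have := mul_le_mul_of_nonneg_right h3 (sq_nonneg ‖u x - u y‖)
      linarith
    refine (sq_le_sq₀ (by positivity) (norm_nonneg _)).1 ?_
    have h6 : (κ * exp (D / 2 - L)) ^ 2 =
        8 * exp (-(2 * L + s)) * ((1 - (cosh (s / 2))⁻¹) / 2 * exp D) := by
      have e4 : exp (D / 2 - L) ^ 2 * exp (-s) = exp (-(2 * L + s)) * exp D := by
        rw [← exp_nat_mul, ← exp_add, ← exp_add]
        congr 1
        push_cast
        ring
      rw [mul_pow, hκ2]
      linear_combination 4 * (1 - (cosh (s / 2))⁻¹) * e4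
    rw [h6]
    refine (mul_le_mul_of_nonneg_left h5 (by positivity)).trans (le_of_eq ?_)
    rw [exp_neg]
    field_simp
  have hinj : Set.InjOn u (S : Set (EuclideanSpace ℝ (Fin (n + 1)))) := by
    intro x hx y hy hxy
    by_contra hne
    have := hsep x hx y hy hne
    rw [hxy, sub_self, norm_zero] at this
    have : 0 < κ * exp (D / 2 - L) := by positivity
    linarith
  have hT : IsSphereSeparated (κ * exp (D / 2 - L)) (S.image u) := by
    constructor
    · intro v hv
      obtain ⟨x, hx, rfl⟩ := Finset.mem_image.1 hv
      exact (hu x hx).1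
    · intro v hv v' hv' hne
      obtain ⟨x, hx, rfl⟩ := Finset.mem_image.1 hv
      obtain ⟨y, hy, rfl⟩ := Finset.mem_image.1 hv'
      exact hsep x hx y hy fun h => hne (by rw [h])
  have hfr : Module.finrank ℝ (EuclideanSpace ℝ (Fin (n + 1))) = n + 1 := by simp
  rw [← Finset.card_image_of_injOn hinj]
  have hpos : 0 < (κ⁻¹) ^ n * exp (n * (L - D / 2)) := by positivity
  -- The packing bound needs separation at most 1; inner shells are only 1-separated for counting,
  -- whence the summand 1.
  rcases le_total (κ * exp (D / 2 - L)) 1 with hle | hge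
  · refine (hT.card_le hfr (by positivity) hle).trans ?_
    gcongr
    rw [mul_inv, ← exp_neg, mul_pow, ← exp_nat_mul, neg_sub]
    linarith
  · refine ((hT.mono hge).card_le hfr one_pos le_rfl).trans ?_
    gcongr
    rw [inv_one, one_pow]
    linarith

lemma exists_card_le_of_isDistinguishable {n : ℕ} (hn : 1 ≤ n) {s : ℝ} (hs : 0 < s) :
    ∃ b : ℝ, 0 < b ∧ ∀ c δ r : ℝ, 0 < c → 0 < δ → s ≤ √c * δ → δ ≤ r →
      ∀ S : Finset (EuclideanSpace ℝ (Fin (n + 1))), IsDistinguishable c δ r S →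
        (S.card : ℝ) ≤ b * exp (n * (√c * r - √c * δ / 2)) := by
  classical
  obtain ⟨w, hw⟩ : ∃ w, w = s / 2 := ⟨_, rfl⟩
  have hw0 : 0 < w := by linarith
  have hcosh : 0 < 1 - (cosh (s / 2))⁻¹ :=
    sub_pos.2 (inv_lt_one_of_one_lt₀ (one_lt_cosh.2 (by linarith)))
  have hκ0 : 0 < 4 * (1 - (cosh (s / 2))⁻¹) * exp (-s) := by positivity
  obtain ⟨κ, hκ⟩ : ∃ κ, κ = √(4 * (1 - (cosh (s / 2))⁻¹) * exp (-s)) := ⟨_, rfl⟩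
  have hκpos : 0 < κ := hκ ▸ sqrt_pos.2 hκ0
  have hκ2 : κ ^ 2 = 4 * (1 - (cosh (s / 2))⁻¹) * exp (-s) := by rw [hκ, sq_sqrt hκ0.le]
  have hn' : (1 : ℝ) ≤ n := by exact_mod_cast hn
  have hq : 0 < exp (n * w) - 1 := sub_pos.2 (one_lt_exp_iff.2 (by positivity))
  refine ⟨(n + 1) * 4 ^ (n + 1) * ((2 / w + 1) + (κ⁻¹) ^ n * (exp (n * w) / (exp (n * w) - 1))),
    by positivity, ?_⟩
  intro c δ r hc hδ hsδ hr S hS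
  have hsc := sqrt_pos.2 hc
  set R := √c * r with hR
  set D := √c * δ with hD
  have hDR : D ≤ R := mul_le_mul_of_nonneg_left hr hsc.le
  have hR0 : 0 < R := by linarith
  set K := ⌊R / w⌋₊ + 1 with hK
  have hKR : (K : ℝ) * w ≤ R + w := by
    have := Nat.floor_le (div_nonneg hR0.le hw0.le)
    rw [le_div_iff₀ hw0] at this
    rw [hK]
    push_cast
    linarith
  have hmaps : ∀ x ∈ S, ⌊√c * hdist c 0 x / w⌋₊ ∈ Finset.range K := by
    intro x hx
    rw [Finset.mem_range, hK, Nat.lt_succ_iff]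
    apply Nat.floor_le_floor
    gcongr
    exact mul_le_mul_of_nonneg_left (hS.1 x hx).2 hsc.le
  have hshell : ∀ k ∈ Finset.range K,
      (({x ∈ S | ⌊√c * hdist c 0 x / w⌋₊ = k}.card : ℕ) : ℝ) ≤ (n + 1) * 4 ^ (n + 1) *
        (1 + (κ⁻¹) ^ n * (exp (n * w) ^ k * exp (-(n * (D / 2))))) := by
    intro k _
    have h := (hS.subset (Finset.filter_subset (fun x => ⌊√c * hdist c 0 x / w⌋₊ = k) S)
      ).card_le_of_shell hs hc hδ hsδ (L := k * w) (κ := κ) ?_ hκpos hκ2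
    · refine h.trans (le_of_eq ?_)
      rw [← exp_nat_mul, ← exp_add, ← hD]
      ring_nf
    · intro x hx
      obtain ⟨hxS, rfl⟩ := Finset.mem_filter.1 hx
      have h1 := Nat.floor_le (div_nonneg (sqrt_mul_hdist_nonneg hc 0 x) hw0.le)
      have h2 := Nat.lt_floor_add_one (√c * hdist c 0 x / w)
      rw [le_div_iff₀ hw0] at h1
      rw [div_lt_iff₀ hw0] at h2
      constructor <;> linarith
  rw [Finset.card_eq_sum_card_fiberwise hmaps, Nat.cast_sum]
  refine (Finset.sum_le_sum hshell).trans ?_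
  rw [← Finset.mul_sum, Finset.sum_add_distrib, ← Finset.mul_sum, ← Finset.sum_mul,
    Finset.sum_const, Finset.card_range, nsmul_eq_mul, mul_one,
    mul_assoc (((n : ℝ) + 1) * 4 ^ (n + 1)) (_ + _) (exp _)]
  refine mul_le_mul_of_nonneg_left ?_ (by positivity)
  rw [add_mul]
  refine add_le_add ?_ ?_
  · have ht : R / 2 ≤ n * (R - D / 2) := by nlinarith
    have h1 : (K : ℝ) ≤ R / w + 1 := by
      rw [hK]
      push_cast
      linarith [Nat.floor_le (div_nonneg hR0.le hw0.le)]
    have h2 := add_one_le_exp ((n : ℝ) * (R - D / 2))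
    have h3 : 1 ≤ exp ((n : ℝ) * (R - D / 2)) := one_le_exp (by linarith : (0 : ℝ) ≤ n * (R - D / 2))
    have h4 : R / w ≤ 2 / w * exp ((n : ℝ) * (R - D / 2)) := by
      rw [div_mul_eq_mul_div]
      gcongr
      linarith
    linarith
  · rw [mul_assoc]
    refine mul_le_mul_of_nonneg_left ?_ (by positivity)
    -- The last shell may overshoot R by at most w, costing a factor exp (n w).
    have h1 : ∑ k ∈ Finset.range K, exp (n * w) ^ k ≤ exp (n * (R + w)) / (exp (n * w) - 1) := by
      rw [geom_sum_eq (by linarith)]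
      gcongr
      rw [← exp_nat_mul]
      have : exp (K * (n * w)) ≤ exp (n * (R + w)) := by
        apply exp_le_exp.2
        nlinarith
      linarith
    refine (mul_le_mul_of_nonneg_right h1 (exp_pos _).le).trans (le_of_eq ?_)
    rw [div_mul_eq_mul_div, div_mul_eq_mul_div, ← exp_add, ← exp_add]
    ring_nf

end PoincareBall

/-- Up to constants depending only on the dimension `d` and on a lower bound `s` for the
dimensionless separation `√c δ`, the capacity is `exp ((d-1) √c (r - δ/2))`. -/
theorem theorem2 (d : ℕ) (hd : 2 ≤ d) (s : ℝ) (hs : 0 < s) :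
    ∃ a b : ℝ, 0 < a ∧ 0 < b ∧
      ∀ c δ r : ℝ, 0 < c → 0 < δ → s ≤ √c * δ → δ ≤ r →
        IsGreatest (PoincareBall.distinguishableCounts d c δ r)
            (PoincareBall.capacity d c δ r) ∧
          a * Real.exp (((d : ℝ) - 1) * √c * (r - δ / 2)) ≤ (PoincareBall.capacity d c δ r : ℝ) ∧
          (PoincareBall.capacity d c δ r : ℝ) ≤
            b * Real.exp (((d : ℝ) - 1) * √c * (r - δ / 2)) := by
  obtain ⟨n, rfl⟩ : ∃ n, d = n + 1 := ⟨d - 1, by omega⟩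
  obtain ⟨b, hb, hub⟩ :=
    PoincareBall.exists_card_le_of_isDistinguishable (n := n) (by omega) hs
  have hs1 : 0 < 1 - Real.exp (-2 * s) := sub_pos.2 (Real.exp_lt_one_iff.2 (by linarith))
  refine ⟨(2 ^ (n + 1))⁻¹ * ((1 - Real.exp (-2 * s)) / 2) ^ n, b, by positivity, hb, ?_⟩
  intro c δ r hc hδ hsδ hr
  have hexp : (((n + 1 : ℕ) : ℝ) - 1) * √c * (r - δ / 2) = n * (√c * r - √c * δ / 2) := by
    push_cast
    ring
  rw [hexp]
  -- Boundedness ensures that `sSup` on ℕ is a true maximum, not the default 0.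
  have hbdd : BddAbove (PoincareBall.distinguishableCounts (n + 1) c δ r) := by
    refine ⟨⌊b * Real.exp (n * (√c * r - √c * δ / 2))⌋₊, ?_⟩
    rintro m ⟨S, hS, rfl⟩
    exact Nat.le_floor (hub c δ r hc hδ hsδ hr S hS)
  obtain ⟨T, hT, hTcard⟩ :=
    PoincareBall.exists_isDistinguishable_card_ge n hs hc hδ hsδ hr
  have hmem : PoincareBall.capacity (n + 1) c δ r ∈
      PoincareBall.distinguishableCounts (n + 1) c δ r := Nat.sSup_mem ⟨_, T, hT, rfl⟩ hbdd
  refine ⟨⟨hmem, fun m hm => le_csSup hbdd hm⟩, hTcard.trans ?_, ?_⟩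
  · exact_mod_cast le_csSup hbdd ⟨T, hT, rfl⟩
  · obtain ⟨S, hS, hcard⟩ := hmem
    rw [← hcard]
    exact hub c δ r hc hδ hsδ hr S hS
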